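/- Let $X_1,\dots,X_k$ be smooth, pointwise linearly independent vector fields on $\mathbb{R}^n$, a global orthonormal frame of a sub-Riemannian (SR) structure. Let $t_0<t_1$, let $u\in L^\infty([t_0,t_1],\mathbb{R}^k)$, and let $q:[t_0,t_1]\to\mathbb{R}^n$ be an SR trajectory with control $u$, i.e. an absolutely continuous solution of $\dot q=\sum_i u_i(t)X_i(q)$ for a.e. $t$. Adapted coordinates. Fix a basis $(e_a)_{a=1}^n$ of $\mathrm{T}^*_{q(t_0)}\mathbb{R}^n$. Let the linear maps $\Lambda^{(1)}(t):\mathrm{T}_{q(t)}\mathbb{R}^n\to\mathbb{R}^n$ and the symmetric bilinear maps $\Lambda^{(2)}(t):\mathrm{T}_{q(t)}\mathbb{R}^n\times\mathrm{T}_{q(t)}\mathbb{R}^n\to\mathbb{R}^n$ be the absolutely continuous solutions of $$\dot\Lambda^{(1)}[b]+\sum_i u_i\,\Lambda^{(1)}[\mathrm{D}_{q}X_i[b]]=0,\qquad \Lambda^{(1)}(t_0)=(e_a)_a,$$ $$\dot\Lambda^{(2)}[b,b]+\sum_i u_i\left\{\Lambda^{(1)}[\mathrm{D}^2_{q}X_i[b,b]]+2\Lambda^{(2)}[\mathrm{D}_{q}X_i[b],b]\right\}=0,\qquad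 \Lambda^{(2)}(t_0)=0,$$ for a.e. $t$ and all $b$. Put $Y_i^{(1)}(t)=\Lambda^{(1)}(t)[X_i(q(t))]$ and $Y_i^{(2)}(t,y)=\Lambda^{(1)}(t)[\mathrm{D}_{q(t)}X_i[A(t)y]]+\Lambda^{(2)}(t)[X_i(q(t)),A(t)y]$, where $A(t)=\Lambda^{(1)}(t)^{-1}$. The characteristic control system is the system $\dot q^{(1)}=\sum_i v_i(t)Y_i^{(1)}(t)$, $\dot c^{(1)}=\sum_i v_i(t)u_i(t)$ in $\mathbb{R}^n\times\mathbb{R}$, with controls $v\in L^\infty([t_0,t_1],\mathbb{R}^k)$. Let $\mathcal R$ be its time-$t_1$ reachable set from the origin. The trajectory $q$ is a *normal* SR extremal if $\mathcal R$ is a proper linear subspace of $\mathbb{R}^{n+1}$ that does not contain $\{0\}\times\mathbb{R}$. Fix $\psi_0\in(\mathbb{R}^n)^*$. The characteristic optimal control problem (OCP) is to minimize $\int_{t_0}^{t_1}\sum_i v_i\langle Y^{(2)}_i(t,q^{(1)}),\psi_0\rangle\,dt$ over the controls $v$ that steer the characteristic control system from the origin to a given point of $\mathcal R$ on $[t_0,t_1]$.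 Its Pontryagin Hamiltonian is $$H(t,q^{(1)},(\psi,a),v)=\Big\langle\sum_i v_iY_i^{(1)}(t),\psi\Big\rangle+a\sum_i v_iu_i(t)+p_0\Big\langle\sum_i v_iY_i^{(2)}(t,q^{(1)}),\psi_0\Big\rangle .$$ A control $\Delta u\in L^\infty([t_0,t_1],\mathbb{R}^k)$, with its trajectory $(q^{(1)},c^{(1)})$ from the origin, and an absolutely continuous covector curve $(\psi,a):[t_0,t_1]\to(\mathbb{R}^n)^*\times\mathbb{R}$ form an *extremal* of the characteristic OCP, *abnormal* if $p_0=0$ and *normal* if $p_0=-1$, if the following hold: $(p_0,\psi(t),a(t))\neq 0$ for all $t$; $\dot\psi=-\partial H/\partial q^{(1)}$ and $\dot a=-\partial H/\partial c^{(1)}=0$ for a.e. $t$; and for a.e. $t$ the function $w\mapsto H(t,q^{(1)}(t),(\psi(t),a(t)),w)$ attains its maximum over $\mathbb{R}^k$ at $w=\Delta u(t)$. In particular $a$ is constant. **Lemma 4.19.** Let $\Delta u$ with $(\psi,a)$ be an extremal of the characteristic OCP with $a\neq 0$. 1. If it is an abnormal extremal, then $q$ is a normal SR extremal and $q$ is of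 class $C^\infty$ on $[t_0,t_1]$. 2. If it is a normal extremal, then $q$ is of class $C^1$ on $[t_0,t_1]$. 3. If it is a normal extremal and the Goh conditions $\langle\Lambda^{(1)}(t)\big[[X_i,X_j](q(t))\big],\psi_0\rangle=0$ hold for all $i,j$ and all $t\in[t_0,t_1]$, then $q$ is of class $C^2$ on $[t_0,t_1]$. -/

import Mathlib

open Set MeasureTheory
open scoped ContDiff ENNReal

noncomputable section

namespace SRGeom

/-- The space `ℝⁿ`. It is the configuration manifold, each of its tangent spaces, and (for `k`) the
space of control values. -/
abbrev Vec (n : ℕ) : Type := EuclideanSpace ℝ (Fin n)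

/-- A curve `x` is a Caratheodory solution of `x' = f (t, x)` on `[t₀, t₁]`: it is absolutely
continuous and satisfies the equation at almost every time of the interval. -/
def IsCaratheodorySolution {F : Type*} [NormedAddCommGroup F] [NormedSpace ℝ F]
    (f : ℝ → F → F) (t₀ t₁ : ℝ) (x : ℝ → F) : Prop :=
  AbsolutelyContinuousOnInterval x t₀ t₁ ∧
    ∀ᵐ t ∂volume.restrict (Icc t₀ t₁), HasDerivAt x (f t (x t)) t

/-- `L^∞` controls on `[t₀, t₁]` with values in `ℝᵏ`. -/
def IsControl {k : ℕ} (t₀ t₁ : ℝ) (u : ℝ → Vec k) : Prop :=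
  MemLp u (⊤ : ℝ≥0∞) (volume.restrict (Icc t₀ t₁))

/-- A sub-Riemannian structure of rank `k` on `ℝⁿ`, given by a global orthonormal frame: smooth,
pointwise linearly independent vector fields `X₁, …, X_k`. The distribution is their span, and the
sub-Riemannian metric is the one for which they are orthonormal. -/
structure SRStructure (n k : ℕ) where
  X : Fin k → Vec n → Vec n
  smooth : ∀ i, ContDiff ℝ ∞ (X i)
  linearIndependent : ∀ p, LinearIndependent ℝ (fun i => X i p)

variable {n k : ℕ}

/-- A sub-Riemannian trajectory `q` on `[t₀, t₁]`, together with its `L^∞` control `u`: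
`q' = ∑ i, uⁱ • X_i (q)`. Only the values on `[t₀, t₁]` matter. -/
structure SRTrajectory (S : SRStructure n k) (t₀ t₁ : ℝ) where
  u : ℝ → Vec k
  q : ℝ → Vec n
  isControl : IsControl t₀ t₁ u
  isSolution : IsCaratheodorySolution (fun t p => ∑ i, u t i • S.X i p) t₀ t₁ q

variable {S : SRStructure n k} {t₀ t₁ : ℝ}

/-- Adapted coordinates along a trajectory. For a basis `e` of the cotangent space at `q (t₀)`,
`L1 (t) : T_{q(t)} ℝⁿ → ℝⁿ` and the symmetric bilinear `L2 (t)` on `T_{q(t)} ℝⁿ` with values in `ℝⁿ`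
are the solutions of the initial value problems
* `L1' [b] + ∑ i, uⁱ L1 [DX_i [b]] = 0`, `L1 (t₀) = (e_a)_a`;
* `L2' [b, b] + ∑ i, uⁱ (L1 [D²X_i [b, b]] + 2 L2 [DX_i [b], b]) = 0`, `L2 (t₀) = 0`. -/
structure AdaptedCoordinates (T : SRTrajectory S t₀ t₁) where
  e : Module.Basis (Fin n) ℝ (Vec n →L[ℝ] ℝ)
  L1 : ℝ → Vec n →L[ℝ] Vec n
  L2 : ℝ → Vec n →L[ℝ] Vec n →L[ℝ] Vec n
  L1_init : ∀ (a : Fin n) (b : Vec n), L1 t₀ b a = e a b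
  L1_ac : AbsolutelyContinuousOnInterval L1 t₀ t₁
  L1_ode : ∀ᵐ t ∂volume.restrict (Icc t₀ t₁), ∀ b : Vec n,
    HasDerivAt (fun s => L1 s b) (-∑ i, T.u t i • L1 t (fderiv ℝ (S.X i) (T.q t) b)) t
  L2_init : L2 t₀ = 0
  L2_symm : ∀ t ∈ Icc t₀ t₁, ∀ b b' : Vec n, L2 t b b' = L2 t b' b
  L2_ac : AbsolutelyContinuousOnInterval L2 t₀ t₁
  L2_ode : ∀ᵐ t ∂volume.restrict (Icc t₀ t₁), ∀ b : Vec n,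
    HasDerivAt (fun s => L2 s b b)
      (-∑ i, T.u t i • (L1 t (fderiv ℝ (fderiv ℝ (S.X i)) (T.q t) b b)
        + (2 : ℝ) • L2 t (fderiv ℝ (S.X i) (T.q t) b) b)) t

namespace AdaptedCoordinates

variable {T : SRTrajectory S t₀ t₁}

/-- `Y_i^{(1)} (t) = L1 (t) [X_i (q (t))]`. -/
def Y1 (C : AdaptedCoordinates T) (i : Fin k) (t : ℝ) : Vec n :=
  C.L1 t (S.X i (T.q t))

/-- `Y_i^{(2)} (t, y) = L1 (t) [DX_i [A (t) y]] + L2 (t) [X_i, A (t) y]` with `A (t) = L1 (t)⁻¹`. -/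
def Y2 (C : AdaptedCoordinates T) (i : Fin k) (t : ℝ) (y : Vec n) : Vec n :=
  C.L1 t (fderiv ℝ (S.X i) (T.q t) ((C.L1 t).inverse y))
    + C.L2 t (S.X i (T.q t)) ((C.L1 t).inverse y)

/-- The right-hand side, at time `t` and control value `v`, of the characteristic control system in
`ℝⁿ × ℝ`: `q⁽¹⁾' = ∑ i, v_i • Y_i^{(1)} (t)`, `c⁽¹⁾' = ∑ i, v_i * u_i (t)`. -/
def charField (C : AdaptedCoordinates T) (t : ℝ) (v : Vec k) : Vec n × ℝ :=
  (∑ i, v i • C.Y1 i t, ∑ i, v i * T.u t i)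

/-- `x = (q⁽¹⁾, c⁽¹⁾)` is the trajectory on `[t₀, τ]`, issuing from the origin, of the characteristic
control system driven by the control `v`. -/
def IsCharTrajectory (C : AdaptedCoordinates T) (τ : ℝ) (v : ℝ → Vec k) (x : ℝ → Vec n × ℝ) :
    Prop :=
  IsCaratheodorySolution (fun t _ => C.charField t (v t)) t₀ τ x ∧ x t₀ = 0

/-- The time-`τ` reachable set from the origin of the characteristic control system. -/
def reachableSet (C : AdaptedCoordinates T) (τ : ℝ) : Set (Vec n × ℝ) :=
  {y | ∃ (v : ℝ → Vec k) (x : ℝ → Vec n × ℝ),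
    IsControl t₀ τ v ∧ C.IsCharTrajectory τ v x ∧ x τ = y}

/-- The trajectory is a sub-Riemannian extremal: the time-`t₁` reachable set of its characteristic
control system is a proper linear subspace of `ℝⁿ × ℝ`. -/
def IsSRExtremal (C : AdaptedCoordinates T) : Prop :=
  ∃ W : Submodule ℝ (Vec n × ℝ), W ≠ ⊤ ∧ C.reachableSet t₁ = (W : Set (Vec n × ℝ))

/-- The trajectory is a normal sub-Riemannian extremal: in addition, the reachable set does not
contain `{0} × ℝ`. -/
def IsNormalSRExtremal (C : AdaptedCoordinates T) : Prop :=
  C.IsSRExtremal ∧ ¬ (({0} : Set (Vec n)) ×ˢ (univ : Set ℝ) ⊆ C.reachableSet t₁)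

/-- The Lagrangian `⟨∑ i, v_i • Y_i^{(2)} (t, q⁽¹⁾), ψ₀⟩` of the characteristic optimal control
problem; its integral is the cost `⟨q⁽²⁾, ψ₀⟩`. -/
def charLagrangian (C : AdaptedCoordinates T) (ψ₀ : Vec n →L[ℝ] ℝ) (t : ℝ) (x : Vec n × ℝ)
    (v : Vec k) : ℝ :=
  ψ₀ (∑ i, v i • C.Y2 i t x.1)

/-- The Pontryagin Hamiltonian of the characteristic optimal control problem. -/
def hamiltonian (C : AdaptedCoordinates T) (ψ₀ : Vec n →L[ℝ] ℝ) (p₀ t : ℝ) (x : Vec n × ℝ)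
    (ψ : Vec n →L[ℝ] ℝ) (a : ℝ) (v : Vec k) : ℝ :=
  ψ (C.charField t v).1 + a * (C.charField t v).2 + p₀ * C.charLagrangian ψ₀ t x v

/-- The control `v`, with trajectory `x = (q⁽¹⁾, c⁽¹⁾)` and covector curve `(ψ, a)`, is an extremal on
`[t₀, t₁]` of the characteristic optimal control problem with covector `ψ₀`, in the sense of the
Pontryagin Maximum Principle with cost multiplier `p₀`. -/
structure IsCharExtremal (C : AdaptedCoordinates T) (ψ₀ : Vec n →L[ℝ] ℝ) (p₀ : ℝ)
    (v : ℝ → Vec k) (x : ℝ → Vec n × ℝ) (ψ : ℝ → Vec n →L[ℝ] ℝ) (a : ℝ → ℝ) : Prop where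
  isControl : IsControl t₀ t₁ v
  trajectory : C.IsCharTrajectory t₁ v x
  ψ_ac : AbsolutelyContinuousOnInterval ψ t₀ t₁
  a_ac : AbsolutelyContinuousOnInterval a t₀ t₁
  /-- the covector `(p₀, ψ, a)` vanishes nowhere -/
  nontrivial : ∀ t ∈ Icc t₀ t₁, (p₀, ψ t, a t) ≠ (0, 0, 0)
  /-- `(ψ, a)' = -∂H/∂x` -/
  adjoint : ∀ᵐ t ∂volume.restrict (Icc t₀ t₁), ∀ b : Vec n × ℝ,
    HasDerivAt (fun s => ψ s b.1 + a s * b.2)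
      (-fderiv ℝ (fun y => C.hamiltonian ψ₀ p₀ t y (ψ t) (a t) (v t)) (x t) b) t
  /-- the Maximum Principle, over all control values -/
  maximum : ∀ᵐ t ∂volume.restrict (Icc t₀ t₁), ∀ w : Vec k,
    C.hamiltonian ψ₀ p₀ t (x t) (ψ t) (a t) w ≤ C.hamiltonian ψ₀ p₀ t (x t) (ψ t) (a t) (v t)

/-- Abnormal extremals of the characteristic optimal control problem: `p₀ = 0`. -/
def IsAbnormalCharExtremal (C : AdaptedCoordinates T) (ψ₀ : Vec n →L[ℝ] ℝ)
    (v : ℝ → Vec k) (x : ℝ → Vec n × ℝ) (ψ : ℝ → Vec n →L[ℝ] ℝ) (a : ℝ → ℝ) : Prop :=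
  C.IsCharExtremal ψ₀ 0 v x ψ a

/-- Normal extremals of the characteristic optimal control problem: `p₀ = -1`. -/
def IsNormalCharExtremal (C : AdaptedCoordinates T) (ψ₀ : Vec n →L[ℝ] ℝ)
    (v : ℝ → Vec k) (x : ℝ → Vec n × ℝ) (ψ : ℝ → Vec n →L[ℝ] ℝ) (a : ℝ → ℝ) : Prop :=
  C.IsCharExtremal ψ₀ (-1) v x ψ a

/-- The Goh conditions for the covector `ψ₀`: the Pontryagin covector `φ (t) = L1 (t)^* ψ₀` annihilates
every bracket `[X_i, X_j]` along the trajectory. -/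
def GohConditions (C : AdaptedCoordinates T) (ψ₀ : Vec n →L[ℝ] ℝ) : Prop :=
  ∀ t ∈ Icc t₀ t₁, ∀ i j : Fin k,
    ψ₀ (C.L1 t (VectorField.lieBracket ℝ (S.X i) (S.X j) (T.q t))) = 0

end AdaptedCoordinates

end SRGeom

end

/-! The Hamiltonian is linear in the control value, so it has a maximum over all of `ℝᵏ` only if
every coefficient vanishes: `ψ(Y1_i) + a u_i + p₀ ψ₀(Y2_i(q⁽¹⁾)) = 0` almost everywhere
(`ae_switching_eq_zero`). Since `a` is a nonzero constant, this solves for the control: `u` agrees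
almost everywhere with a feedback built from `q`, `L1`, `L2`, `q⁽¹⁾` and `ψ` (`ae_control_eq`). An
absolutely continuous curve whose a.e. derivative is `C^m` is itself `C^(m+1)`, so each degree of
smoothness of the feedback yields one more for `q`, `L1` and `L2`.

In the abnormal case `ψ` is constant and the feedback involves only `q` and `L1`, so the bootstrap
never stops. The constant covector `(ψ, a)` also annihilates the reachable set but not `(0, 1)`,
which makes `q` a normal SR extremal.

In the normal case the feedback is continuous, hence `q` is `C¹`. In general the argument stops
there, because the derivatives of `q⁽¹⁾` and `ψ` contain the merely bounded control `Δu`. The terms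
in `Δu` enter the derivative of the feedback through the antisymmetric part of `ψ₀(Y2_i(Y1_j))`,
which is the Goh bracket up to sign. Under the Goh conditions they cancel, the feedback is `C¹`, and
`q` is `C²`.

Both smoothness of the inverse of `L1` and the bracket computation need `L1 t` to be invertible;
this follows from a backward Gronwall estimate (`eq_zero_of_comp_L1`). -/

/-! ### Calculus of absolutely continuous curves -/

namespace AbsolutelyContinuousOnInterval

/-- An absolutely continuous curve composed with a map that is Lipschitz on its image. -/
theorem lipschitzOnWith_comp {E F : Type*} [PseudoMetricSpace E] [PseudoMetricSpace F]
    {f : ℝ → E} {a b : ℝ} (hf : AbsolutelyContinuousOnInterval f a b) {φ : E → F} {K : NNReal}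
    (hφ : LipschitzOnWith K φ (f '' uIcc a b)) :
    AbsolutelyContinuousOnInterval (fun t => φ (f t)) a b := by
  rw [absolutelyContinuousOnInterval_iff] at hf ⊢
  intro ε hε
  -- `K + 1` instead of `K` keeps the quotient meaningful when `K = 0`.
  obtain ⟨δ, hδ, h⟩ := hf (ε / (K + 1)) (by positivity)
  refine ⟨δ, hδ, fun I hI hlen => ?_⟩
  have hK : (0 : ℝ) < K + 1 := by positivity
  calc ∑ i ∈ Finset.range I.1, dist (φ (f (I.2 i).1)) (φ (f (I.2 i).2))
      ≤ ∑ i ∈ Finset.range I.1, (K + 1) * dist (f (I.2 i).1) (f (I.2 i).2) := by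
        refine Finset.sum_le_sum fun i hi => ?_
        refine (hφ.dist_le_mul _ (mem_image_of_mem _ (hI.1 i hi).1) _
          (mem_image_of_mem _ (hI.1 i hi).2)).trans ?_
        gcongr
        linarith
    _ = (K + 1) * ∑ i ∈ Finset.range I.1, dist (f (I.2 i).1) (f (I.2 i).2) := by
        rw [Finset.mul_sum]
    _ < (K + 1) * (ε / (K + 1)) := by
        gcongr
        exact h I hI hlen
    _ = ε := by field_simp

/-- An absolutely continuous curve in a finite-dimensional space composed with a `C¹` map. -/
theorem contDiff_comp {E F : Type*} [NormedAddCommGroup E] [NormedSpace ℝ E]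
    [FiniteDimensional ℝ E] [NormedAddCommGroup F] [NormedSpace ℝ F]
    {f : ℝ → E} {a b : ℝ} (hf : AbsolutelyContinuousOnInterval f a b) {φ : E → F}
    (hφ : ContDiff ℝ 1 φ) : AbsolutelyContinuousOnInterval (fun t => φ (f t)) a b := by
  obtain ⟨R, hR⟩ := hf.exists_bound
  have : ProperSpace E := FiniteDimensional.proper ℝ E
  -- A closed ball containing the image is compact and convex, so a `C¹` map is Lipschitz on it.
  obtain ⟨K, hK⟩ := (hφ.contDiffOn (s := Metric.closedBall (0 : E) R)).exists_lipschitzOnWith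
    one_ne_zero (convex_closedBall _ _) (isCompact_closedBall _ _)
  refine hf.lipschitzOnWith_comp (hK.mono ?_)
  rintro _ ⟨t, ht, rfl⟩
  simpa using hR t ht

theorem clm_comp {E F : Type*} [NormedAddCommGroup E] [NormedSpace ℝ E]
    [NormedAddCommGroup F] [NormedSpace ℝ F]
    {f : ℝ → E} {a b : ℝ} (hf : AbsolutelyContinuousOnInterval f a b) (φ : E →L[ℝ] F) :
    AbsolutelyContinuousOnInterval (fun t => φ (f t)) a b :=
  hf.lipschitzOnWith_comp φ.lipschitz.lipschitzOnWith

theorem clm_apply_const {E F : Type*} [NormedAddCommGroup E] [NormedSpace ℝ E]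
    [NormedAddCommGroup F] [NormedSpace ℝ F] {f : ℝ → E →L[ℝ] F} {a b : ℝ}
    (hf : AbsolutelyContinuousOnInterval f a b) (y : E) :
    AbsolutelyContinuousOnInterval (fun t => f t y) a b :=
  hf.clm_comp (ContinuousLinearMap.apply ℝ F y)

theorem prodMk {E F : Type*} [PseudoMetricSpace E] [PseudoMetricSpace F]
    {f : ℝ → E} {g : ℝ → F} {a b : ℝ} (hf : AbsolutelyContinuousOnInterval f a b)
    (hg : AbsolutelyContinuousOnInterval g a b) :
    AbsolutelyContinuousOnInterval (fun t => (f t, g t)) a b := by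
  refine squeeze_zero (fun t => Finset.sum_nonneg fun i _ => by positivity) (fun t => ?_)
    (by simpa using Filter.Tendsto.add hf hg)
  rw [← Finset.sum_add_distrib]
  refine Finset.sum_le_sum fun i _ => ?_
  rw [Prod.dist_eq]
  exact max_le_add_of_nonneg dist_nonneg dist_nonneg

theorem continuousOn_Icc {E : Type*} [NormedAddCommGroup E] {f : ℝ → E} {a b : ℝ} (hab : a ≤ b)
    (hf : AbsolutelyContinuousOnInterval f a b) : ContinuousOn f (Icc a b) := by
  have h := hf.continuousOn
  rwa [uIcc_of_le hab] at h

/-- If the derivative of an absolutely continuous curve agrees almost everywhere with a continuous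
function, then it agrees with it everywhere. -/
theorem hasDerivWithinAt {F : Type*} [NormedAddCommGroup F] [NormedSpace ℝ F] [CompleteSpace F]
    {f g : ℝ → F} {a b : ℝ} (hab : a ≤ b) (hf : AbsolutelyContinuousOnInterval f a b)
    (hfg : ∀ᵐ t ∂volume.restrict (Icc a b), HasDerivAt f (g t) t)
    (hg : ContinuousOn g (Icc a b)) {t : ℝ} (ht : t ∈ Icc a b) :
    HasDerivWithinAt f (g t) (Icc a b) t := by
  -- Extending `g` continuously to the line makes its primitive `C¹` everywhere, endpoints included.
  -- The difference of `f` and this primitive then has zero derivative almost everywhere and is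
  -- constant.
  set G : ℝ → F := IccExtend hab (fun s => g s) with hG
  have hGc : Continuous G := by
    rw [continuous_IccExtend_iff]
    exact continuousOn_iff_continuous_domRestrict.1 hg
  have hGeq : ∀ s ∈ Icc a b, G s = g s := fun s hs => by rw [hG, IccExtend_of_mem _ _ hs]
  have hI : ∀ s, HasDerivAt (fun r => ∫ w in a..r, G w) (G s) s := fun s =>
    intervalIntegral.integral_hasDerivAt_right (hGc.intervalIntegrable _ _)
      (hGc.stronglyMeasurableAtFilter _ _) hGc.continuousAt
  have hIc : ContDiff ℝ 1 (fun r => ∫ w in a..r, G w) := by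
    rw [contDiff_one_iff_deriv]
    refine ⟨fun s => (hI s).differentiableAt, ?_⟩
    rwa [show deriv (fun r => ∫ w in a..r, G w) = G from funext fun s => (hI s).deriv]
  obtain ⟨c, hc⟩ := (hf.sub hIc.contDiffOn.absolutelyContinuousOnInterval).const_of_ae_hasDerivAt_zero
    (by
      rw [ae_restrict_iff' measurableSet_Icc] at hfg
      filter_upwards [hfg] with s hs hsm
      rw [uIcc_of_le hab] at hsm
      simpa [hGeq s hsm] using (hs hsm).sub (hI s))
  rw [uIcc_of_le hab] at hc
  have h := ((hI t).add_const c).hasDerivWithinAt (s := Icc a b)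
  rw [hGeq t ht] at h
  refine h.congr_of_mem (fun s hs => ?_) ht
  have := hc s hs
  simp only [Pi.sub_apply] at this
  rw [← this]
  abel

/-- The engine of the bootstrap: by `hasDerivWithinAt`, `g` is the derivative within the closed
interval at every point, so its smoothness passes to `f` with one degree gained. -/
theorem contDiffOn_succ {F : Type*} [NormedAddCommGroup F] [NormedSpace ℝ F] [CompleteSpace F]
    {f g : ℝ → F} {a b : ℝ} (hab : a < b) (hf : AbsolutelyContinuousOnInterval f a b)
    (hfg : ∀ᵐ t ∂volume.restrict (Icc a b), HasDerivAt f (g t) t) {m : ℕ}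
    (hg : ContDiffOn ℝ m g (Icc a b)) : ContDiffOn ℝ ((m + 1 : ℕ) : WithTop ℕ∞) f (Icc a b) := by
  have h := fun t ht => hf.hasDerivWithinAt hab.le hfg hg.continuousOn (t := t) ht
  push_cast
  rw [contDiffOn_succ_iff_derivWithin (uniqueDiffOn_Icc hab)]
  refine ⟨fun t ht => (h t ht).differentiableWithinAt, by simp, hg.congr fun t ht => ?_⟩
  exact (h t ht).derivWithin (uniqueDiffOn_Icc hab t ht)

theorem eq_of_ae_hasDerivAt_zero {F : Type*} [NormedAddCommGroup F] [NormedSpace ℝ F]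
    {f : ℝ → F} {a b : ℝ} (hab : a ≤ b) (hf : AbsolutelyContinuousOnInterval f a b)
    (h0 : ∀ᵐ t ∂volume.restrict (Icc a b), HasDerivAt f 0 t) {s t : ℝ} (hs : s ∈ Icc a b)
    (ht : t ∈ Icc a b) : f s = f t := by
  rw [ae_restrict_iff' measurableSet_Icc] at h0
  obtain ⟨c, hc⟩ := hf.const_of_ae_hasDerivAt_zero (by rwa [uIcc_of_le hab])
  rw [uIcc_of_le hab] at hc
  rw [hc s hs, hc t ht]

/-- Backward Gronwall inequality: a nonnegative absolutely continuous function with `f' ≥ -K f` that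
vanishes at the right end of an interval vanishes at its left end. -/
theorem eq_zero_left {f : ℝ → ℝ} {a b K : ℝ} (hab : a ≤ b)
    (hf : AbsolutelyContinuousOnInterval f a b)
    (hder : ∀ᵐ t ∂volume.restrict (Icc a b), ∃ d, HasDerivAt f d t ∧ -(K * f t) ≤ d)
    (h0 : 0 ≤ f a) (hb : f b = 0) : f a = 0 := by
  -- Integrating factor: the derivative of `exp (K t) f t` is nonnegative, while its integral equals
  -- `-exp (K a) f a`.
  have hexp : ContDiff ℝ 1 (fun t : ℝ => Real.exp (K * t)) := by fun_prop
  have hh := (hexp.contDiffOn (s := uIcc a b)).absolutelyContinuousOnInterval.fun_mul hf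
  have hint := hh.integral_deriv_eq_sub
  have hpos : 0 ≤ ∫ t in a..b, deriv (fun t => Real.exp (K * t) * f t) t := by
    refine intervalIntegral.integral_nonneg_of_ae_restrict hab ?_
    filter_upwards [hder] with t ⟨d, hd, hle⟩
    have he : HasDerivAt (fun t : ℝ => Real.exp (K * t)) (Real.exp (K * t) * (K * 1)) t :=
      ((hasDerivAt_id t).const_mul K).exp
    rw [(he.fun_mul hd).deriv]
    have := Real.exp_pos (K * t)
    simp only [Pi.zero_apply]
    nlinarith
  rw [hint, hb, mul_zero, zero_sub] at hpos
  have := Real.exp_pos (K * a)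
  nlinarith

end AbsolutelyContinuousOnInterval

/-- In finite dimension, the strong derivative of a curve of linear maps can be computed
pointwise. -/
theorem hasDerivAt_clm_of_forall_apply {E F : Type*} [NormedAddCommGroup E] [NormedSpace ℝ E]
    [FiniteDimensional ℝ E] [NormedAddCommGroup F] [NormedSpace ℝ F] [FiniteDimensional ℝ F]
    {M : ℝ → E →L[ℝ] F} {D : E →L[ℝ] F} {t : ℝ}
    (h : ∀ b, HasDerivAt (fun s => M s b) (D b) t) : HasDerivAt M D t := by
  let B := Module.finBasis ℝ E
  -- A linear map is identified with its values on a basis, which reduces the claim to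
  -- differentiation in a finite product.
  let e : (Fin (Module.finrank ℝ E) → F) ≃L[ℝ] (E →L[ℝ] F) :=
    ((B.constr ℝ).trans LinearMap.toContinuousLinearMap).toContinuousLinearEquiv
  have key : ∀ N : E →L[ℝ] F, e (fun j => N (B j)) = N := fun N => by
    ext b
    have : B.constr ℝ (fun j => N (B j)) = (N : E →ₗ[ℝ] F) := B.ext fun j => by simp
    exact congrArg (fun f : E →ₗ[ℝ] F => f b) this
  have h1 : HasDerivAt (fun s => fun j => M s (B j)) (fun j => D (B j)) t :=
    hasDerivAt_pi.2 fun j => h (B j)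
  have h2 := e.toContinuousLinearMap.hasFDerivAt.comp_hasDerivAt t h1
  simp only [ContinuousLinearEquiv.coe_coe, key] at h2
  refine h2.congr_of_eventuallyEq (Filter.Eventually.of_forall fun s => ?_)
  exact (key (M s)).symm

/-! ### Adapted coordinates: linearized equation and invertibility of `L1` -/

namespace SRGeom

variable {n k : ℕ} {S : SRStructure n k} {t₀ t₁ : ℝ} {T : SRTrajectory S t₀ t₁}

theorem SRTrajectory.continuousOn (ht : t₀ ≤ t₁) (T : SRTrajectory S t₀ t₁) :
    ContinuousOn T.q (Icc t₀ t₁) := by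
  simpa [uIcc_of_le ht] using T.isSolution.1.continuousOn

namespace AdaptedCoordinates

theorem hasDerivAt_L1 (C : AdaptedCoordinates T) : ∀ᵐ t ∂volume.restrict (Icc t₀ t₁),
    HasDerivAt C.L1 (-∑ i, T.u t i • (C.L1 t ∘L fderiv ℝ (S.X i) (T.q t))) t := by
  filter_upwards [C.L1_ode] with t h
  refine hasDerivAt_clm_of_forall_apply fun b => ?_
  simpa [sum_apply] using h b

/-- The linearized field `∑ i, uⁱ DX_i` is essentially bounded along the trajectory. -/
theorem ae_norm_linearization_le (ht : t₀ ≤ t₁) (T : SRTrajectory S t₀ t₁) :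
    ∃ K, ∀ᵐ t ∂volume.restrict (Icc t₀ t₁),
      ‖∑ i, T.u t i • fderiv ℝ (S.X i) (T.q t)‖ ≤ K := by
  have hc : ∀ i, ∃ c, ∀ t ∈ Icc t₀ t₁, ‖fderiv ℝ (S.X i) (T.q t)‖ ≤ c := fun i =>
    isCompact_Icc.exists_bound_of_continuousOn
      (((S.smooth i).continuous_fderiv (by simp)).comp_continuousOn (T.continuousOn ht))
  choose c hc using hc
  set M := (eLpNormEssSup T.u (volume.restrict (Icc t₀ t₁))).toReal
  have hM : ∀ᵐ t ∂volume.restrict (Icc t₀ t₁), ‖T.u t‖ ≤ M := by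
    have htop : eLpNormEssSup T.u (volume.restrict (Icc t₀ t₁)) ≠ ⊤ := by
      have := T.isControl.2
      rw [eLpNorm_exponent_top] at this
      exact this.ne
    filter_upwards [ae_le_eLpNormEssSup (f := T.u) (μ := volume.restrict (Icc t₀ t₁))] with t h
    simpa using ENNReal.toReal_mono htop h
  refine ⟨∑ i, M * c i, ?_⟩
  filter_upwards [hM, ae_restrict_mem measurableSet_Icc] with t hu htm
  refine (norm_sum_le _ _).trans (Finset.sum_le_sum fun i _ => ?_)
  rw [norm_smul]
  exact mul_le_mul ((PiLp.norm_apply_le _ _).trans hu) (hc i t htm) (norm_nonneg _)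
    ((norm_nonneg _).trans hu)

/-- The components of `L1 t₀` are the basis covectors `e a`, so the hypothesis is a linear relation
among them. -/
theorem eq_zero_of_comp_L1_init (C : AdaptedCoordinates T) {w : Vec n →L[ℝ] ℝ}
    (h : ∀ b, w (C.L1 t₀ b) = 0) : w = 0 := by
  have hw : ∀ y : Vec n, w y = ∑ a, y a * w (EuclideanSpace.single a 1) := fun y => by
    conv_lhs => rw [← (EuclideanSpace.basisFun (Fin n) ℝ).sum_repr y]
    simp
  have h0 : ∑ a, w (EuclideanSpace.single a 1) • C.e a = 0 := by
    ext b
    have := h b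
    rw [hw] at this
    simpa [sum_apply, C.L1_init, mul_comm] using this
  have h1 := Fintype.linearIndependent_iff.1 C.e.linearIndependent _ h0
  ext y
  simp [hw y, h1]

/-- Cauchy–Schwarz. The sum of squares on the right replaces the squared dual norm in the Gronwall
argument, since it is polynomial in `φ` and easily differentiated along a curve. -/
theorem sq_apply_le (φ : Vec n →L[ℝ] ℝ) (v : Vec n) :
    φ v ^ 2 ≤ ‖v‖ ^ 2 * ∑ j, φ (EuclideanSpace.single j 1) ^ 2 := by
  have hw : φ v = ∑ a, v a * φ (EuclideanSpace.single a 1) := by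
    conv_lhs => rw [← (EuclideanSpace.basisFun (Fin n) ℝ).sum_repr v]
    simp
  rw [hw, EuclideanSpace.real_norm_sq_eq]
  exact Finset.sum_mul_sq_le_sq_mul_sq _ _ _

/-- A covector annihilated by the transpose of `L1 t` vanishes. -/
theorem eq_zero_of_comp_L1 (C : AdaptedCoordinates T) {t : ℝ} (ht : t ∈ Icc t₀ t₁)
    {w : Vec n →L[ℝ] ℝ} (h : ∀ b, w (C.L1 t b) = 0) : w = 0 := by
  obtain ⟨K, hK⟩ := ae_norm_linearization_le (ht.1.trans ht.2) T
  have hsub : Icc t₀ t ⊆ Icc t₀ t₁ := Icc_subset_Icc_right ht.2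
  let E : Fin n → Vec n := fun j => EuclideanSpace.single j 1
  have hAC : AbsolutelyContinuousOnInterval (fun s => ∑ j, w (C.L1 s (E j)) ^ 2) t₀ t := by
    refine (C.L1_ac.mono ?_).contDiff_comp
      (φ := fun N : Vec n →L[ℝ] Vec n => ∑ j, w (N (E j)) ^ 2) (by fun_prop)
    rwa [uIcc_of_le ht.1, uIcc_of_le (ht.1.trans ht.2)]
  -- The energy vanishes at `t`, and Gronwall carries this back to `t₀`, where `L1` is known. In the
  -- constant, `1` comes from `2xy ≤ x² + y²`, and `n * K ^ 2` from bounding each of the `n` terms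
  -- `y²` by `K²` times the energy.
  have h0 := hAC.eq_zero_left (K := 1 + n * K ^ 2) ht.1 ?_
    (Finset.sum_nonneg fun j _ => sq_nonneg _) (by simp [h])
  · refine C.eq_zero_of_comp_L1_init fun b => ?_
    have h1 := sq_apply_le (w ∘L C.L1 t₀) b
    change _ ≤ ‖b‖ ^ 2 * ∑ j, w (C.L1 t₀ (E j)) ^ 2 at h1
    rw [h0, mul_zero] at h1
    exact pow_eq_zero_iff two_ne_zero |>.1 (le_antisymm h1 (sq_nonneg _))
  · filter_upwards [ae_restrict_of_ae_restrict_of_subset hsub hK,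
      ae_restrict_of_ae_restrict_of_subset hsub C.L1_ode] with s hKs hs
    set B := ∑ i, T.u s i • fderiv ℝ (S.X i) (T.q s) with hB
    have hd : ∀ b, HasDerivAt (fun r => w (C.L1 r b)) (-w (C.L1 s (B b))) s := fun b => by
      have := w.hasFDerivAt.comp_hasDerivAt s (hs b)
      simpa [hB, sum_apply, Function.comp_def] using this
    refine ⟨_, HasDerivAt.fun_sum fun j _ => (hd (E j)).pow 2, ?_⟩
    have hj : ∀ j, w (C.L1 s (B (E j))) ^ 2 ≤ K ^ 2 * ∑ j, w (C.L1 s (E j)) ^ 2 := fun j => by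
      refine (sq_apply_le (w ∘L C.L1 s) (B (E j))).trans ?_
      refine mul_le_mul_of_nonneg_right ?_ (Finset.sum_nonneg fun j _ => sq_nonneg _)
      have : ‖B (E j)‖ ≤ K := by
        simpa [E] using (B.le_opNorm (E j)).trans (mul_le_mul_of_nonneg_right hKs (norm_nonneg _))
      gcongr
    have hsum : ∑ j, (w (C.L1 s (E j)) ^ 2 + K ^ 2 * ∑ j, w (C.L1 s (E j)) ^ 2)
        = (1 + n * K ^ 2) * ∑ j, w (C.L1 s (E j)) ^ 2 := by
      rw [Finset.sum_add_distrib]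
      simp
      ring
    rw [← hsum, ← Finset.sum_neg_distrib]
    refine Finset.sum_le_sum fun j _ => ?_
    have := hj j
    push_cast
    nlinarith [sq_nonneg (w (C.L1 s (E j)) - w (C.L1 s (B (E j))))]

/-- A proper range would lie in the kernel of a nonzero covector, contrary to `eq_zero_of_comp_L1`;
in equal finite dimensions surjectivity suffices. -/
theorem exists_equiv_L1 (C : AdaptedCoordinates T) {t : ℝ} (ht : t ∈ Icc t₀ t₁) :
    ∃ e : Vec n ≃L[ℝ] Vec n, (e : Vec n →L[ℝ] Vec n) = C.L1 t := by
  have hsurj : Function.Surjective (C.L1 t : Vec n →ₗ[ℝ] Vec n) := by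
    rw [← LinearMap.range_eq_top]
    by_contra hne
    obtain ⟨f, hf, hle⟩ := Submodule.exists_le_ker_of_lt_top _ (lt_top_iff_ne_top.2 hne)
    refine hf ?_
    have := C.eq_zero_of_comp_L1 ht (w := LinearMap.toContinuousLinearMap f)
      fun b => hle (LinearMap.mem_range_self _ b)
    simpa using this
  refine ⟨(LinearEquiv.ofBijective _
    ⟨LinearMap.injective_iff_surjective.2 hsurj, hsurj⟩).toContinuousLinearEquiv, ?_⟩
  ext b
  rfl

theorem inverse_L1_apply (C : AdaptedCoordinates T) {t : ℝ} (ht : t ∈ Icc t₀ t₁) (b : Vec n) :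
    (C.L1 t).inverse (C.L1 t b) = b := by
  obtain ⟨e, he⟩ := C.exists_equiv_L1 ht
  rw [← he, ContinuousLinearMap.inverse_equiv]
  simp

/-! ### Regularity bootstrap for `q`, `L1` and `L2` -/

theorem contDiffOn_inverse_L1 (C : AdaptedCoordinates T) {m : WithTop ℕ∞}
    (h : ContDiffOn ℝ m C.L1 (Icc t₀ t₁)) :
    ContDiffOn ℝ m (fun t => (C.L1 t).inverse) (Icc t₀ t₁) := fun t ht => by
  obtain ⟨e, he⟩ := C.exists_equiv_L1 ht
  have := contDiffAt_map_inverse (𝕜 := ℝ) (n := m) e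
  rw [he] at this
  exact this.comp_contDiffWithinAt t (h t ht)

theorem contDiffOn_Y1 (C : AdaptedCoordinates T) {m : ℕ}
    (hq : ContDiffOn ℝ m T.q (Icc t₀ t₁)) (h1 : ContDiffOn ℝ m C.L1 (Icc t₀ t₁)) (i : Fin k) :
    ContDiffOn ℝ m (C.Y1 i) (Icc t₀ t₁) :=
  h1.clm_apply (((S.smooth i).of_le (by exact_mod_cast le_top)).comp_contDiffOn hq)

/-- The linear form `y ↦ ⟨Y_i^{(2)} (t, y), ψ₀⟩`. -/
noncomputable def Y2Form (C : AdaptedCoordinates T) (ψ₀ : Vec n →L[ℝ] ℝ) (i : Fin k) (t : ℝ) :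
    Vec n →L[ℝ] ℝ :=
  ψ₀ ∘L ((C.L1 t ∘L fderiv ℝ (S.X i) (T.q t)) + C.L2 t (S.X i (T.q t))) ∘L (C.L1 t).inverse

@[simp]
theorem Y2Form_apply (C : AdaptedCoordinates T) (ψ₀ : Vec n →L[ℝ] ℝ) (i : Fin k) (t : ℝ)
    (y : Vec n) : C.Y2Form ψ₀ i t y = ψ₀ (C.Y2 i t y) := rfl

theorem contDiffOn_Y2Form (C : AdaptedCoordinates T) (ψ₀ : Vec n →L[ℝ] ℝ) {m : ℕ}
    (hq : ContDiffOn ℝ m T.q (Icc t₀ t₁)) (h1 : ContDiffOn ℝ m C.L1 (Icc t₀ t₁))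
    (h2 : ContDiffOn ℝ m C.L2 (Icc t₀ t₁)) (i : Fin k) :
    ContDiffOn ℝ m (C.Y2Form ψ₀ i) (Icc t₀ t₁) := by
  have hX : ContDiffOn ℝ m (fun t => S.X i (T.q t)) (Icc t₀ t₁) :=
    ((S.smooth i).of_le (by exact_mod_cast le_top)).comp_contDiffOn hq
  have hDX : ContDiffOn ℝ m (fun t => fderiv ℝ (S.X i) (T.q t)) (Icc t₀ t₁) :=
    ((S.smooth i).fderiv_right (by exact_mod_cast le_top)).comp_contDiffOn hq
  exact contDiffOn_const.clm_comp
    (((h1.clm_comp hDX).add (h2.clm_apply hX)).clm_comp (C.contDiffOn_inverse_L1 h1))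

/-- One step of the regularity bootstrap for the trajectory. -/
theorem _root_.SRGeom.SRTrajectory.contDiffOn_succ (ht : t₀ < t₁) (T : SRTrajectory S t₀ t₁)
    {m : ℕ} {v : ℝ → Fin k → ℝ} (hv : ∀ i, ContDiffOn ℝ m (fun t => v t i) (Icc t₀ t₁))
    (huv : ∀ᵐ t ∂volume.restrict (Icc t₀ t₁), ∀ i, T.u t i = v t i)
    (hq : ContDiffOn ℝ m T.q (Icc t₀ t₁)) :
    ContDiffOn ℝ ((m + 1 : ℕ) : WithTop ℕ∞) T.q (Icc t₀ t₁) := by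
  refine T.isSolution.1.contDiffOn_succ ht (g := fun t => ∑ i, v t i • S.X i (T.q t)) ?_ ?_
  · filter_upwards [T.isSolution.2, huv] with t h hu
    simpa [hu] using h
  · exact ContDiffOn.sum fun i _ =>
      (hv i).smul (((S.smooth i).of_le (by exact_mod_cast le_top)).comp_contDiffOn hq)

theorem contDiffOn_L1_succ (ht : t₀ < t₁) (C : AdaptedCoordinates T)
    {m : ℕ} {v : ℝ → Fin k → ℝ} (hv : ∀ i, ContDiffOn ℝ m (fun t => v t i) (Icc t₀ t₁))
    (huv : ∀ᵐ t ∂volume.restrict (Icc t₀ t₁), ∀ i, T.u t i = v t i)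
    (hq : ContDiffOn ℝ m T.q (Icc t₀ t₁)) (h1 : ContDiffOn ℝ m C.L1 (Icc t₀ t₁)) :
    ContDiffOn ℝ ((m + 1 : ℕ) : WithTop ℕ∞) C.L1 (Icc t₀ t₁) := by
  refine C.L1_ac.contDiffOn_succ ht
    (g := fun t => -∑ i, v t i • (C.L1 t ∘L fderiv ℝ (S.X i) (T.q t))) ?_ ?_
  · filter_upwards [C.hasDerivAt_L1, huv] with t h hu
    simpa [hu] using h
  · exact (ContDiffOn.sum fun i _ => (hv i).smul (h1.clm_comp
      (((S.smooth i).fderiv_right (by exact_mod_cast le_top)).comp_contDiffOn hq))).neg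

/-- The differential equation governs only the quadratic form `L2 t b b`. The gain of regularity is
proved for it and transferred to the bilinear map by polarization, using symmetry. -/
theorem contDiffOn_L2_succ (ht : t₀ < t₁) (C : AdaptedCoordinates T)
    {m : ℕ} {v : ℝ → Fin k → ℝ} (hv : ∀ i, ContDiffOn ℝ m (fun t => v t i) (Icc t₀ t₁))
    (huv : ∀ᵐ t ∂volume.restrict (Icc t₀ t₁), ∀ i, T.u t i = v t i)
    (hq : ContDiffOn ℝ m T.q (Icc t₀ t₁)) (h1 : ContDiffOn ℝ m C.L1 (Icc t₀ t₁))
    (h2 : ContDiffOn ℝ m C.L2 (Icc t₀ t₁)) :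
    ContDiffOn ℝ ((m + 1 : ℕ) : WithTop ℕ∞) C.L2 (Icc t₀ t₁) := by
  have hdiag : ∀ b, ContDiffOn ℝ ((m + 1 : ℕ) : WithTop ℕ∞) (fun t => C.L2 t b b)
      (Icc t₀ t₁) := fun b => by
    have hac : AbsolutelyContinuousOnInterval (fun t => C.L2 t b b) t₀ t₁ :=
      (C.L2_ac.clm_apply_const b).clm_apply_const b
    refine hac.contDiffOn_succ ht
      (g := fun t => -∑ i, v t i • (C.L1 t (fderiv ℝ (fderiv ℝ (S.X i)) (T.q t) b b)
        + (2 : ℝ) • C.L2 t (fderiv ℝ (S.X i) (T.q t) b) b)) ?_ ?_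
    · filter_upwards [C.L2_ode, huv] with t h hu
      simpa [hu] using h b
    · refine (ContDiffOn.sum fun i _ => (hv i).smul ?_).neg
      have hD : ContDiff ℝ ∞ (fderiv ℝ (S.X i)) := (S.smooth i).fderiv_right (by simp)
      have hDX : ContDiffOn ℝ m (fun t => fderiv ℝ (S.X i) (T.q t)) (Icc t₀ t₁) :=
        (hD.of_le (by exact_mod_cast le_top)).comp_contDiffOn hq
      have hDDX : ContDiffOn ℝ m (fun t => fderiv ℝ (fderiv ℝ (S.X i)) (T.q t)) (Icc t₀ t₁) :=
        (hD.fderiv_right (by exact_mod_cast le_top)).comp_contDiffOn hq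
      have hDDXb : ContDiffOn ℝ m (fun t => fderiv ℝ (fderiv ℝ (S.X i)) (T.q t) b) (Icc t₀ t₁) :=
        hDDX.clm_apply contDiffOn_const
      have hL2b : ContDiffOn ℝ m (fun t => C.L2 t (fderiv ℝ (S.X i) (T.q t) b)) (Icc t₀ t₁) :=
        h2.clm_apply (hDX.clm_apply contDiffOn_const)
      exact (h1.clm_apply (hDDXb.clm_apply contDiffOn_const)).add
        ((hL2b.clm_apply contDiffOn_const).const_smul (2 : ℝ))
  rw [contDiffOn_clm_apply]
  intro b
  rw [contDiffOn_clm_apply]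
  intro b'
  refine (((hdiag (b + b')).sub (hdiag b)).sub (hdiag b')).const_smul (1 / 2 : ℝ) |>.congr ?_
  intro t htm
  have := C.L2_symm t htm b' b
  simp only [map_add, add_apply, this]
  module

end AdaptedCoordinates

end SRGeom

/-! ### Consequences of the Maximum Principle -/

namespace SRGeom

variable {n k : ℕ} {S : SRStructure n k} {t₀ t₁ : ℝ} {T : SRTrajectory S t₀ t₁}

namespace AdaptedCoordinates

theorem contDiffOn_zero_curves (ht : t₀ ≤ t₁) (C : AdaptedCoordinates T) :
    ContDiffOn ℝ (0 : ℕ) T.q (Icc t₀ t₁) ∧ ContDiffOn ℝ (0 : ℕ) C.L1 (Icc t₀ t₁) ∧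
      ContDiffOn ℝ (0 : ℕ) C.L2 (Icc t₀ t₁) := by
  simp only [Nat.cast_zero, contDiffOn_zero]
  exact ⟨T.continuousOn ht, C.L1_ac.continuousOn_Icc ht, C.L2_ac.continuousOn_Icc ht⟩

/-- Exhibits linearity in the control; the coefficients are the switching functions. -/
theorem hamiltonian_eq_sum (C : AdaptedCoordinates T) (ψ₀ : Vec n →L[ℝ] ℝ) (p₀ t : ℝ)
    (x : Vec n × ℝ) (ψ : Vec n →L[ℝ] ℝ) (a : ℝ) (v : Vec k) :
    C.hamiltonian ψ₀ p₀ t x ψ a v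
      = ∑ i, v i * (ψ (C.Y1 i t) + a * T.u t i + p₀ * C.Y2Form ψ₀ i t x.1) := by
  simp only [hamiltonian, charField, charLagrangian, map_sum, map_smul, smul_eq_mul,
    Finset.mul_sum, ← Finset.sum_add_distrib, Y2Form_apply]
  exact Finset.sum_congr rfl fun i _ => by ring

theorem fderiv_hamiltonian (C : AdaptedCoordinates T) (ψ₀ : Vec n →L[ℝ] ℝ) (p₀ t : ℝ)
    (x b : Vec n × ℝ) (ψ : Vec n →L[ℝ] ℝ) (a : ℝ) (v : Vec k) :
    fderiv ℝ (fun y => C.hamiltonian ψ₀ p₀ t y ψ a v) x b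
      = p₀ * ∑ i, v i * C.Y2Form ψ₀ i t b.1 := by
  have h : HasFDerivAt (fun y => C.hamiltonian ψ₀ p₀ t y ψ a v)
      (∑ i, v i • p₀ • (C.Y2Form ψ₀ i t ∘L ContinuousLinearMap.fst ℝ (Vec n) ℝ)) x := by
    simp only [hamiltonian_eq_sum]
    refine HasFDerivAt.fun_sum fun i _ => HasFDerivAt.const_mul (HasFDerivAt.const_add _
      (HasFDerivAt.const_mul ?_ _)) _
    exact (C.Y2Form ψ₀ i t ∘L ContinuousLinearMap.fst ℝ (Vec n) ℝ).hasFDerivAt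
  rw [h.fderiv, Finset.mul_sum]
  simp only [sum_apply, smul_apply, ContinuousLinearMap.comp_apply,
    ContinuousLinearMap.coe_fst', smul_eq_mul]
  exact Finset.sum_congr rfl fun i _ => by ring

namespace IsCharExtremal

variable {C : AdaptedCoordinates T} {ψ₀ : Vec n →L[ℝ] ℝ} {p₀ : ℝ} {v : ℝ → Vec k}
  {x : ℝ → Vec n × ℝ} {ψ : ℝ → Vec n →L[ℝ] ℝ} {a : ℝ → ℝ}

/-- A linear function that is bounded above vanishes: the switching functions of an extremal are
zero. -/
theorem ae_switching_eq_zero (h : C.IsCharExtremal ψ₀ p₀ v x ψ a) :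
    ∀ᵐ t ∂volume.restrict (Icc t₀ t₁), ∀ i,
      ψ t (C.Y1 i t) + a t * T.u t i + p₀ * C.Y2Form ψ₀ i t (x t).1 = 0 := by
  filter_upwards [h.maximum] with t hmax i
  set c := fun i => ψ t (C.Y1 i t) + a t * T.u t i + p₀ * C.Y2Form ψ₀ i t (x t).1 with hc
  -- Moving the control by `c i` in direction `i` raises the Hamiltonian by `(c i)²`, so maximality
  -- forces `c i = 0`.
  have h1 := hmax (v t + EuclideanSpace.single i (c i))
  simp only [hamiltonian_eq_sum] at h1
  change ∑ j, (v t + EuclideanSpace.single i (c i)) j * c j ≤ ∑ j, v t j * c j at h1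
  have h2 : ∑ j, (v t + EuclideanSpace.single i (c i)) j * c j = ∑ j, v t j * c j + c i * c i := by
    simp [add_mul, Finset.sum_add_distrib]
  change c i = 0
  nlinarith [mul_self_nonneg (c i)]

theorem ae_hasDerivAt_covector (h : C.IsCharExtremal ψ₀ p₀ v x ψ a) :
    ∀ᵐ t ∂volume.restrict (Icc t₀ t₁), ∀ b,
      HasDerivAt (fun s => ψ s b) (-(p₀ * ∑ i, v t i * C.Y2Form ψ₀ i t b)) t := by
  filter_upwards [h.adjoint] with t ht b
  simpa [fderiv_hamiltonian] using ht (b, 0)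

theorem multiplier_eq (ht : t₀ ≤ t₁) (h : C.IsCharExtremal ψ₀ p₀ v x ψ a) {s t : ℝ}
    (hs : s ∈ Icc t₀ t₁) (htm : t ∈ Icc t₀ t₁) : a s = a t := by
  refine h.a_ac.eq_of_ae_hasDerivAt_zero ht ?_ hs htm
  filter_upwards [h.adjoint] with t ht
  -- The direction `(0, 1)` isolates `a`, and the Hamiltonian does not depend on `c⁽¹⁾`.
  simpa [fderiv_hamiltonian, -Y2Form_apply] using ht (0, 1)

/-- On an extremal whose constant multiplier `α` is nonzero, the control is given by feedback. -/
theorem ae_control_eq (ht : t₀ ≤ t₁) (h : C.IsCharExtremal ψ₀ p₀ v x ψ a) {τ : ℝ}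
    (hτ : τ ∈ Icc t₀ t₁) (ha : a τ ≠ 0) :
    ∀ᵐ t ∂volume.restrict (Icc t₀ t₁), ∀ i,
      T.u t i = -(a τ)⁻¹ * (p₀ * C.Y2Form ψ₀ i t (x t).1 + ψ t (C.Y1 i t)) := by
  filter_upwards [h.ae_switching_eq_zero, ae_restrict_mem measurableSet_Icc] with t h0 htm i
  have := h0 i
  rw [h.multiplier_eq ht htm hτ] at this
  field_simp
  linarith

theorem continuousOn_curves (ht : t₀ ≤ t₁) (h : C.IsCharExtremal ψ₀ p₀ v x ψ a) :
    ContinuousOn ψ (Icc t₀ t₁) ∧ ContinuousOn (fun t => (x t).1) (Icc t₀ t₁) :=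
  ⟨h.ψ_ac.continuousOn_Icc ht, (h.trajectory.1.1.continuousOn_Icc ht).fst⟩

end IsCharExtremal

/-- The reachable set of the characteristic control system is a linear subspace. -/
theorem exists_submodule_eq_reachableSet (C : AdaptedCoordinates T) (τ : ℝ) :
    ∃ W : Submodule ℝ (Vec n × ℝ), C.reachableSet τ = W := by
  refine ⟨{ carrier := C.reachableSet τ, add_mem' := ?_, zero_mem' := ?_, smul_mem' := ?_ }, rfl⟩
  · rintro _ _ ⟨v, x, hv, ⟨⟨hac, hd⟩, h0⟩, rfl⟩ ⟨v', x', hv', ⟨⟨hac', hd'⟩, h0'⟩, rfl⟩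
    refine ⟨v + v', x + x', hv.add hv', ⟨⟨hac.add hac', ?_⟩, by simp [h0, h0']⟩, rfl⟩
    filter_upwards [hd, hd'] with t h h'
    refine (h.add h').congr_deriv ?_
    simp [charField, add_smul, add_mul, Finset.sum_add_distrib]
  · refine ⟨0, 0, MemLp.zero, ⟨⟨?_, ?_⟩, rfl⟩, rfl⟩
    · exact (contDiff_const (n := 1) (c := (0 : Vec n × ℝ))).contDiffOn.absolutelyContinuousOnInterval
    · filter_upwards with t
      refine (hasDerivAt_const t (0 : Vec n × ℝ)).congr_deriv ?_
      simp [charField, Prod.ext_iff]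
  · rintro c _ ⟨v, x, hv, ⟨⟨hac, hd⟩, h0⟩, rfl⟩
    refine ⟨c • v, c • x, hv.const_smul c, ⟨⟨hac.const_smul c, ?_⟩, by simp [h0]⟩, rfl⟩
    filter_upwards [hd] with t h
    refine (h.const_smul c).congr_deriv ?_
    simp [charField, mul_smul, Finset.smul_sum, Finset.mul_sum, mul_assoc]

/-! ### Abnormal extremals -/

namespace IsAbnormalCharExtremal

variable {C : AdaptedCoordinates T} {ψ₀ : Vec n →L[ℝ] ℝ} {v : ℝ → Vec k}
  {x : ℝ → Vec n × ℝ} {ψ : ℝ → Vec n →L[ℝ] ℝ} {a : ℝ → ℝ}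

/-- With `p₀ = 0` the Hamiltonian no longer depends on the state, so the adjoint equation reads `ψ'
= 0`. -/
theorem covector_eq (ht : t₀ ≤ t₁) (h : C.IsAbnormalCharExtremal ψ₀ v x ψ a) {s t : ℝ}
    (hs : s ∈ Icc t₀ t₁) (htm : t ∈ Icc t₀ t₁) : ψ s = ψ t := by
  refine h.ψ_ac.eq_of_ae_hasDerivAt_zero ht ?_ hs htm
  filter_upwards [IsCharExtremal.ae_hasDerivAt_covector h] with t ht
  exact hasDerivAt_clm_of_forall_apply fun b => by simpa using ht b

/-- Along any trajectory of the characteristic system, the derivative of the pairing with the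
constant covector is a combination of switching functions, which vanish; the pairing starts at zero.
-/
theorem covector_reachable_eq_zero (ht : t₀ ≤ t₁) (h : C.IsAbnormalCharExtremal ψ₀ v x ψ a)
    {y : Vec n × ℝ} (hy : y ∈ C.reachableSet t₁) : ψ t₀ y.1 + a t₀ * y.2 = 0 := by
  obtain ⟨w, z, -, ⟨⟨hac, hd⟩, h0⟩, rfl⟩ := hy
  have hleft : t₀ ∈ Icc t₀ t₁ := left_mem_Icc.2 ht
  let ℓ : Vec n × ℝ →L[ℝ] ℝ := (ψ t₀).coprod (a t₀ • ContinuousLinearMap.id ℝ ℝ)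
  have hℓ : ∀ y, ℓ y = ψ t₀ y.1 + a t₀ * y.2 := fun y => by simp [ℓ]
  have := (hac.clm_comp ℓ).eq_of_ae_hasDerivAt_zero ht ?_ (right_mem_Icc.2 ht) hleft
  · rw [← hℓ, this, h0, map_zero]
  · filter_upwards [hd, IsCharExtremal.ae_switching_eq_zero h,
      ae_restrict_mem measurableSet_Icc] with t hdt hsw htm
    have h1 := ℓ.hasFDerivAt.comp_hasDerivAt t hdt
    refine h1.congr_deriv ?_
    have h2 : ∀ i, ψ t₀ (C.Y1 i t) + a t₀ * T.u t i = 0 := fun i => by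
      have := hsw i
      rwa [zero_mul, add_zero, h.covector_eq ht htm hleft,
        IsCharExtremal.multiplier_eq ht h htm hleft] at this
    rw [hℓ]
    simp only [charField, map_sum, map_smul, smul_eq_mul, Finset.mul_sum,
      ← Finset.sum_add_distrib]
    refine Finset.sum_eq_zero fun i _ => ?_
    linear_combination w t i * h2 i

theorem isNormalSRExtremal (ht : t₀ ≤ t₁) (h : C.IsAbnormalCharExtremal ψ₀ v x ψ a)
    (ha : a t₀ ≠ 0) : C.IsNormalSRExtremal := by
  obtain ⟨W, hW⟩ := C.exists_submodule_eq_reachableSet t₁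
  have hnot : ((0, 1) : Vec n × ℝ) ∉ C.reachableSet t₁ := fun hmem =>
    ha (by simpa using h.covector_reachable_eq_zero ht hmem)
  refine ⟨⟨W, ?_, hW⟩, fun hsub => hnot (hsub (by simp))⟩
  rintro rfl
  exact hnot (by simp [hW])

theorem contDiffOn_infty (ht : t₀ < t₁) (h : C.IsAbnormalCharExtremal ψ₀ v x ψ a)
    (ha : a t₀ ≠ 0) : ContDiffOn ℝ ∞ T.q (Icc t₀ t₁) := by
  have hleft : t₀ ∈ Icc t₀ t₁ := left_mem_Icc.2 ht.le
  have hu : ∀ᵐ t ∂volume.restrict (Icc t₀ t₁), ∀ i,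
      T.u t i = -(a t₀)⁻¹ * ψ t₀ (C.Y1 i t) := by
    filter_upwards [IsCharExtremal.ae_control_eq ht.le h hleft ha,
      ae_restrict_mem measurableSet_Icc] with t hut htm i
    rw [hut i, h.covector_eq ht.le htm hleft, zero_mul, zero_add]
  -- The feedback depends on `q` and `L1` alone, so the induction closes on this pair without `L2`.
  have key : ∀ m : ℕ, ContDiffOn ℝ m T.q (Icc t₀ t₁) ∧ ContDiffOn ℝ m C.L1 (Icc t₀ t₁) := by
    intro m
    induction m with
    | zero => exact ⟨(C.contDiffOn_zero_curves ht.le).1, (C.contDiffOn_zero_curves ht.le).2.1⟩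
    | succ m ih =>
      have hv : ∀ i, ContDiffOn ℝ m (fun t => -(a t₀)⁻¹ * ψ t₀ (C.Y1 i t)) (Icc t₀ t₁) :=
        fun i => contDiffOn_const.mul
          ((ψ t₀).contDiff.comp_contDiffOn (C.contDiffOn_Y1 ih.1 ih.2 i))
      exact ⟨T.contDiffOn_succ ht hv hu ih.1, C.contDiffOn_L1_succ ht hv hu ih.1 ih.2⟩
  exact _root_.contDiffOn_infty.2 fun m => (key m).1

end IsAbnormalCharExtremal

/-! ### Normal extremals and the Goh conditions -/

/-- Under the Goh conditions the forms `(b_i, b_j) ↦ ⟨Y_i^{(2)} (t, Y_j^{(1)}), ψ₀⟩` are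
symmetric. -/
theorem GohConditions.Y2Form_Y1_comm {C : AdaptedCoordinates T} {ψ₀ : Vec n →L[ℝ] ℝ}
    (hG : C.GohConditions ψ₀) {t : ℝ} (ht : t ∈ Icc t₀ t₁) (i j : Fin k) :
    C.Y2Form ψ₀ i t (C.Y1 j t) = C.Y2Form ψ₀ j t (C.Y1 i t) := by
  have h := hG t ht i j
  simp only [VectorField.lieBracket, map_sub] at h
  -- The inverse of `L1 t` sends `Y1 j` back to `X_j`. The `L2` terms agree by symmetry, and the
  -- `L1` terms differ by the Lie bracket up to sign.
  simp only [Y2Form_apply, Y2, Y1, C.inverse_L1_apply ht, map_add,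
    C.L2_symm t ht (S.X i (T.q t))]
  linarith

namespace IsNormalCharExtremal

variable {C : AdaptedCoordinates T} {ψ₀ : Vec n →L[ℝ] ℝ} {v : ℝ → Vec k}
  {x : ℝ → Vec n × ℝ} {ψ : ℝ → Vec n →L[ℝ] ℝ} {a : ℝ → ℝ}

theorem continuousOn_feedback (ht : t₀ ≤ t₁) (h : C.IsNormalCharExtremal ψ₀ v x ψ a) (c : ℝ)
    (i : Fin k) : ContDiffOn ℝ (0 : ℕ) (fun t => -c *
      (-1 * C.Y2Form ψ₀ i t (x t).1 + ψ t (C.Y1 i t))) (Icc t₀ t₁) := by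
  obtain ⟨hq, h1, h2⟩ := C.contDiffOn_zero_curves ht
  have hY := C.contDiffOn_Y1 hq h1 i
  have hZ := C.contDiffOn_Y2Form ψ₀ hq h1 h2 i
  obtain ⟨hψ, hx⟩ := IsCharExtremal.continuousOn_curves ht h
  simp only [Nat.cast_zero, contDiffOn_zero] at hY hZ ⊢
  exact continuousOn_const.mul ((continuousOn_const.mul (hZ.clm_apply hx)).add (hψ.clm_apply hY))

theorem contDiffOn_curves_one (ht : t₀ < t₁) (h : C.IsNormalCharExtremal ψ₀ v x ψ a)
    (ha : a t₀ ≠ 0) : ContDiffOn ℝ (1 : ℕ) T.q (Icc t₀ t₁) ∧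
      ContDiffOn ℝ (1 : ℕ) C.L1 (Icc t₀ t₁) ∧ ContDiffOn ℝ (1 : ℕ) C.L2 (Icc t₀ t₁) := by
  have hu := IsCharExtremal.ae_control_eq ht.le h (left_mem_Icc.2 ht.le) ha
  have hv := fun i => h.continuousOn_feedback ht.le (a t₀)⁻¹ i
  obtain ⟨hq, h1, h2⟩ := C.contDiffOn_zero_curves ht.le
  exact ⟨T.contDiffOn_succ ht hv hu hq, C.contDiffOn_L1_succ ht hv hu hq h1,
    C.contDiffOn_L2_succ ht hv hu hq h1 h2⟩

set_option maxHeartbeats 1000000 in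
/-- Under the Goh conditions the derivative of the feedback does not depend on the control `v`, and
is continuous. -/
theorem contDiffOn_feedback_one (ht : t₀ < t₁) (h : C.IsNormalCharExtremal ψ₀ v x ψ a)
    (ha : a t₀ ≠ 0) (hG : C.GohConditions ψ₀) (c : ℝ) (i : Fin k) :
    ContDiffOn ℝ (1 : ℕ) (fun t => -c *
      (-1 * C.Y2Form ψ₀ i t (x t).1 + ψ t (C.Y1 i t))) (Icc t₀ t₁) := by
  obtain ⟨hq, h1, h2⟩ := h.contDiffOn_curves_one ht ha
  have hY := C.contDiffOn_Y1 hq h1 i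
  have hZ := C.contDiffOn_Y2Form ψ₀ hq h1 h2 i
  obtain ⟨hψ, hx⟩ := IsCharExtremal.continuousOn_curves ht.le h
  have huniq := uniqueDiffOn_Icc ht
  set Y' := derivWithin (C.Y1 i) (Icc t₀ t₁) with hY'
  set Z' := derivWithin (C.Y2Form ψ₀ i) (Icc t₀ t₁) with hZ'
  have hY'c : ContinuousOn Y' (Icc t₀ t₁) :=
    hY.continuousOn_derivWithin huniq (by norm_num)
  have hZ'c : ContinuousOn Z' (Icc t₀ t₁) :=
    hZ.continuousOn_derivWithin huniq (by norm_num)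
  have hYac : AbsolutelyContinuousOnInterval (C.Y1 i) t₀ t₁ :=
    ContDiffOn.absolutelyContinuousOnInterval (by rw [uIcc_of_le ht.le]; exact_mod_cast hY)
  have hZac : AbsolutelyContinuousOnInterval (C.Y2Form ψ₀ i) t₀ t₁ :=
    ContDiffOn.absolutelyContinuousOnInterval (by rw [uIcc_of_le ht.le]; exact_mod_cast hZ)
  have heval : ContDiff ℝ 1 (fun p : (Vec n →L[ℝ] ℝ) × Vec n => p.1 p.2) :=
    contDiff_fst.clm_apply contDiff_snd
  have hxac : AbsolutelyContinuousOnInterval (fun t => (x t).1) t₀ t₁ :=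
    h.trajectory.1.1.clm_comp (ContinuousLinearMap.fst ℝ (Vec n) ℝ)
  have hac : AbsolutelyContinuousOnInterval
      (fun t => -1 * C.Y2Form ψ₀ i t (x t).1 + ψ t (C.Y1 i t)) t₀ t₁ :=
    (((hZac.prodMk hxac).contDiff_comp heval).const_mul (-1)).add
      ((h.ψ_ac.prodMk hYac).contDiff_comp heval)
  refine contDiffOn_const.mul (hac.contDiffOn_succ ht (m := 0)
    (g := fun t => -Z' t (x t).1 + ψ t (Y' t)) ?_ ?_)
  -- The endpoints are negligible, and at interior points derivatives within the interval are
  -- genuine derivatives.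
  · have hIoo : ∀ᵐ t ∂volume.restrict (Icc t₀ t₁), t ∈ Ioo t₀ t₁ := by
      rw [← restrict_Ioo_eq_restrict_Icc]
      exact ae_restrict_mem measurableSet_Ioo
    filter_upwards [hIoo, h.trajectory.1.2, IsCharExtremal.ae_hasDerivAt_covector h]
      with t htm hxd hψd
    have htm' := Ioo_subset_Icc_self htm
    have hnhds := Icc_mem_nhds htm.1 htm.2
    have hYd : HasDerivAt (C.Y1 i) (Y' t) t :=
      ((hY.differentiableOn (by norm_num) t htm').hasDerivWithinAt).hasDerivAt hnhds
    have hZd : HasDerivAt (C.Y2Form ψ₀ i) (Z' t) t :=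
      ((hZ.differentiableOn (by norm_num) t htm').hasDerivWithinAt).hasDerivAt hnhds
    have hx1 : HasDerivAt (fun t => (x t).1) (∑ j, v t j • C.Y1 j t) t := hxd.fst
    have hψ' : HasDerivAt ψ (∑ j, v t j • C.Y2Form ψ₀ j t) t :=
      hasDerivAt_clm_of_forall_apply fun b => by simpa [sum_apply] using hψd b
    refine (((hZd.clm_apply hx1).const_mul (-1)).add (hψ'.clm_apply hYd)).congr_deriv ?_
    simp only [map_sum, map_smul, sum_apply, smul_apply, smul_eq_mul]
    -- The left sum comes from the derivative of `q⁽¹⁾`, the right one from that of `ψ`. They enter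
    -- with opposite signs and are the only terms containing `v`.
    have hsymm : ∑ j, v t j * C.Y2Form ψ₀ i t (C.Y1 j t)
        = ∑ j, v t j * C.Y2Form ψ₀ j t (C.Y1 i t) :=
      Finset.sum_congr rfl fun j _ => by rw [hG.Y2Form_Y1_comm htm' i j]
    rw [hsymm]
    ring
  · simp only [Nat.cast_zero, contDiffOn_zero]
    exact (hZ'c.clm_apply hx).neg.add (hψ.clm_apply hY'c)

theorem contDiffOn_two (ht : t₀ < t₁) (h : C.IsNormalCharExtremal ψ₀ v x ψ a)
    (ha : a t₀ ≠ 0) (hG : C.GohConditions ψ₀) : ContDiffOn ℝ (2 : ℕ) T.q (Icc t₀ t₁) :=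
  T.contDiffOn_succ ht (fun i => h.contDiffOn_feedback_one ht ha hG (a t₀)⁻¹ i)
    (IsCharExtremal.ae_control_eq ht.le h (left_mem_Icc.2 ht.le) ha)
    (h.contDiffOn_curves_one ht ha).1

end IsNormalCharExtremal

end AdaptedCoordinates

end SRGeom

theorem lemma4p19 {n k : ℕ} (S : SRGeom.SRStructure n k) (t₀ t₁ : ℝ) (ht : t₀ < t₁)
    (T : SRGeom.SRTrajectory S t₀ t₁) (C : SRGeom.AdaptedCoordinates T)
    (ψ₀ : SRGeom.Vec n →L[ℝ] ℝ)
    (Δu : ℝ → SRGeom.Vec k) (x : ℝ → SRGeom.Vec n × ℝ)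
    (ψ : ℝ → SRGeom.Vec n →L[ℝ] ℝ) (a : ℝ → ℝ)
    (ha : ∃ t ∈ Icc t₀ t₁, a t ≠ 0) :
    (C.IsAbnormalCharExtremal ψ₀ Δu x ψ a →
      C.IsNormalSRExtremal ∧ ContDiffOn ℝ ∞ T.q (Icc t₀ t₁)) ∧
    (C.IsNormalCharExtremal ψ₀ Δu x ψ a →
      ContDiffOn ℝ 1 T.q (Icc t₀ t₁)) ∧
    (C.IsNormalCharExtremal ψ₀ Δu x ψ a → C.GohConditions ψ₀ →
      ContDiffOn ℝ 2 T.q (Icc t₀ t₁)) := by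
  obtain ⟨τ, hτ, haτ⟩ := ha
  have ha₀ : ∀ {p₀ : ℝ}, C.IsCharExtremal ψ₀ p₀ Δu x ψ a → a t₀ ≠ 0 := fun h => by
    rwa [h.multiplier_eq ht.le (left_mem_Icc.2 ht.le) hτ]
  refine ⟨fun h => ⟨h.isNormalSRExtremal ht.le (ha₀ h), h.contDiffOn_infty ht (ha₀ h)⟩,
    fun h => ?_, fun h hG => ?_⟩
  · exact_mod_cast (h.contDiffOn_curves_one ht (ha₀ h)).1
  · exact_mod_cast h.contDiffOn_two ht (ha₀ h) hG
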